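/- **Definitions.** Let $B_4=\langle \sigma_1,\sigma_2,\sigma_3\mid \sigma_1\sigma_2\sigma_1=\sigma_2\sigma_1\sigma_2,\ \sigma_2\sigma_3\sigma_2=\sigma_3\sigma_2\sigma_3,\ \sigma_1\sigma_3=\sigma_3\sigma_1\rangle$ be the braid group on four strings (modulo its centre it is a subgroup of index two in $\mathrm{Aut}(F_2)$), let $\delta=\sigma_1\sigma_2\sigma_3$, and let $a_{ij}=(\sigma_i\cdots\sigma_{j-2})\,\sigma_{j-1}\,(\sigma_i\cdots\sigma_{j-2})^{-1}$, $1\le i<j\le 4$, be its six band generators. The *Brady complex* $X$ is the following 2-complex. As a simplicial complex, its vertices are the cosets $g\langle\delta\rangle$, $g\in B_4$, and its 2-simplices are the sets $\{g\langle\delta\rangle,\ gx\langle\delta\rangle,\ gxy\langle\delta\rangle\}$, where $g\in B_4$ and $x,y,z$ are band generators with $xyz=\delta$. Each simplicial edge is a side of either two or three 2-simplices. Those that are sides of three are the edges of $X$; those that are sides of two are called short diagonals. The faces of $X$ are the *triangles*, that is, the 2-simplices whose three sides are edges of $X$, and the *lozenges*, that is, the unions of two distinct 2-simplices along a common short diagonal.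 An *enveloping surface* in $X$ is a connected surface without boundary, made of faces of $X$ glued along edges of $X$, which visits every edge of $X$ precisely once; that is, a nonempty set of faces such that every edge of $X$ lies on the boundary of precisely two faces of the set, and any two faces of the set are joined by a chain of faces of the set in which consecutive ones share an edge. A *Hamiltonian surface* in $X$ is an enveloping surface without multiple vertices, that is, one that passes through every vertex of $X$ precisely once: its link at every vertex of $X$ is a single cycle, passing through all the edges of $X$ at that vertex. **Theorem.** Every lozenge of the Brady complex $X$ is contained in exactly one Hamiltonian surface in $X$. -/

import Mathlib

namespace Brady

/-- Artin's relators for the braid group on four strings. -/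
def artinRels : Set (FreeGroup (Fin 3)) :=
  {FreeGroup.of 0 * FreeGroup.of 1 * FreeGroup.of 0 *
      (FreeGroup.of 1 * FreeGroup.of 0 * FreeGroup.of 1)⁻¹,
    FreeGroup.of 1 * FreeGroup.of 2 * FreeGroup.of 1 *
      (FreeGroup.of 2 * FreeGroup.of 1 * FreeGroup.of 2)⁻¹,
    FreeGroup.of 0 * FreeGroup.of 2 * (FreeGroup.of 2 * FreeGroup.of 0)⁻¹}

/-- The braid group `B₄` on four strings. Modulo its centre it is a subgroup of index two
in `Aut(F₂)`. -/
abbrev B4 : Type := PresentedGroup artinRels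

/-- The standard generators `σ₁, σ₂, σ₃` of `B₄` (indexed from `0`). -/
def σ (i : Fin 3) : B4 := PresentedGroup.of i

/-- The dual Garside element `δ = σ₁σ₂σ₃`; its power `δ⁴` generates the centre of `B₄`. -/
def δ : B4 := σ 0 * σ 1 * σ 2

/-- The six band generators
`a_{ij} = (σ_i ⋯ σ_{j-2}) σ_{j-1} (σ_i ⋯ σ_{j-2})⁻¹`, `1 ≤ i < j ≤ 4`, of `B₄`
(in the order `a₁₂, a₂₃, a₃₄, a₁₃, a₂₄, a₁₄`). -/
def bandGenerators : Set B4 :=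
  {σ 0, σ 1, σ 2,
    σ 0 * σ 1 * (σ 0)⁻¹,
    σ 1 * σ 2 * (σ 1)⁻¹,
    σ 0 * σ 1 * σ 2 * (σ 0 * σ 1)⁻¹}

/-- The vertices of the Brady complex `X`: the left cosets `g⟨δ⟩` in `B₄`. -/
abbrev Vertex : Type := B4 ⧸ Subgroup.zpowers δ

/-- The vertex `g⟨δ⟩`. -/
def vtx (g : B4) : Vertex := QuotientGroup.mk g

/-- The 2-simplices (given by their vertex sets) of the Brady complex, seen as a simplicial
complex: the sets `{g⟨δ⟩, gx⟨δ⟩, gxy⟨δ⟩}`, where `g ∈ B₄` and `x, y, z` are band generators with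
`xyz = δ`. -/
def simplices : Set (Set Vertex) :=
  {T | ∃ g : B4, ∃ x ∈ bandGenerators, ∃ y ∈ bandGenerators, ∃ z ∈ bandGenerators,
    x * y * z = δ ∧ T = {vtx g, vtx (g * x), vtx (g * x * y)}}

/-- The sides of a 2-simplex: the unordered pairs of distinct vertices of it. -/
def sides (T : Set Vertex) : Set (Sym2 Vertex) :=
  {e | ¬ e.IsDiag ∧ ∀ v ∈ e, v ∈ T}

/-- The order of a simplicial edge: the number of 2-simplices that it is a side of. -/
noncomputable def order (e : Sym2 Vertex) : ℕ∞ :=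
  {T | T ∈ simplices ∧ e ∈ sides T}.encard

/-- The edges of the Brady complex, as a complex of triangles and lozenges: the simplicial edges
of order three. (The other simplicial edges have order two; they are the short diagonals of the
lozenges.) -/
def edges : Set (Sym2 Vertex) := {e | order e = 3}

/-- The triangles of `X`: the 2-simplices all of whose sides are edges of order three.
A 2-cell of `X` is given by the set of edges in its boundary. -/
def IsTriangle (f : Set (Sym2 Vertex)) : Prop :=
  ∃ T ∈ simplices, sides T ⊆ edges ∧ f = sides T

/-- The lozenges of `X`: the unions of two distinct 2-simplices along a common side of order two
(the short diagonal). The boundary consists of the four remaining sides. -/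
def IsLozenge (f : Set (Sym2 Vertex)) : Prop :=
  ∃ T ∈ simplices, ∃ T' ∈ simplices, ∃ d : Sym2 Vertex,
    T ≠ T' ∧ d ∈ sides T ∧ d ∈ sides T' ∧ order d = 2 ∧ f = (sides T ∪ sides T') \ {d}

/-- The 2-cells of the Brady complex, each given by its set of boundary edges. -/
def faces : Set (Set (Sym2 Vertex)) := {f | IsTriangle f ∨ IsLozenge f}

/-- The link at the vertex `v` of the union of a set `S` of faces: its vertices are the edges of
`X` at `v`, and two of them are joined when they bound a corner at `v` of a face in `S`. -/
def link (S : Set (Set (Sym2 Vertex))) (v : Vertex) :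
    SimpleGraph {e : Sym2 Vertex // e ∈ edges ∧ v ∈ e} where
  Adj e e' := e ≠ e' ∧ ∃ f ∈ S, e.1 ∈ f ∧ e'.1 ∈ f
  symm := ⟨fun _ _ h => ⟨h.1.symm, h.2.imp fun _ hf => ⟨hf.1, hf.2.2, hf.2.1⟩⟩⟩
  loopless := ⟨fun _ h => h.1 rfl⟩

/-- Enveloping surfaces in `X`, given by their faces: connected surfaces without boundary that
visit every edge of `X` precisely once. That is, along every edge of `X` precisely two faces of `S`
meet, and any two faces of `S` are joined by a chain of faces of `S` in which consecutive ones share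
an edge. Gluing the faces of `S` along the edges of `X` gives a connected surface without boundary:
every vertex of `X` lies on finitely many edges, so the link of `S` there, in which every vertex has
degree two, is a disjoint union of circles. There may be several of these circles, and then the
surface has a multiple vertex there. -/
structure IsEnvelopingSurface (S : Set (Set (Sym2 Vertex))) : Prop where
  subset_faces : S ⊆ faces
  nonempty : S.Nonempty
  two_faces : ∀ e ∈ edges, {f | f ∈ S ∧ e ∈ f}.encard = 2
  connected : ∀ f ∈ S, ∀ f' ∈ S,
    Relation.ReflTransGen (fun a b => a ∈ S ∧ b ∈ S ∧ (a ∩ b).Nonempty) f f'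

/-- Hamiltonian surfaces in `X`: enveloping surfaces without multiple vertices. That is, the
surface passes through every vertex of `X` precisely once: its link there is a single circle. -/
structure IsHamiltonianSurface (S : Set (Set (Sym2 Vertex))) : Prop
    extends IsEnvelopingSurface S where
  link_connected : ∀ v : Vertex, (link S v).Connected

end Brady

/-!
Let `τ = σ₁δ` and `θ = τδ`. Then `τ³ = δ⁴` is central, and the edges of `X` are the pairs
`{k⟨δ⟩, kτ⟨δ⟩}`, so that they correspond to the elements `k` of `B₄` modulo its centre. In this
indexing the triangle of `k` has the edges `k, kτ, kτ²` and the lozenge of `k` has the edges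
`k, kθ, kδ², kδ²θ`. Every edge lies on one triangle and on two lozenges, hence an enveloping surface
omits exactly one of these three faces.

For a Hamiltonian surface, connectedness of the link at `k⟨δ⟩` rules out that the lozenges of `k`
and `kδ`, which have obtuse corners there, are both present. It follows that the surface contains
all triangles, that its set of lozenges is invariant under `k ↦ kτ`, and that `k ↦ kδ` exchanges the
lozenges in it with those outside it. Since `τ` and `δ` generate `B₄`, the surface consists of all
triangles and of the lozenges with one parity of the exponent sum. Conversely, these faces form a
Hamiltonian surface.
-/

namespace Brady

theorem braid_σ_zero_σ_one : σ 0 * σ 1 * σ 0 = σ 1 * σ 0 * σ 1 :=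
  PresentedGroup.mk_eq_mk_of_mul_inv_mem (rels := artinRels) (by simp [artinRels])

theorem braid_σ_one_σ_two : σ 1 * σ 2 * σ 1 = σ 2 * σ 1 * σ 2 :=
  PresentedGroup.mk_eq_mk_of_mul_inv_mem (rels := artinRels) (by simp [artinRels])

theorem commute_σ_zero_σ_two : Commute (σ 0) (σ 2) :=
  PresentedGroup.mk_eq_mk_of_mul_inv_mem (rels := artinRels) (by simp [artinRels])

theorem semiconjBy_δ_σ_zero : SemiconjBy δ (σ 0) (σ 1) :=
  calc σ 0 * σ 1 * σ 2 * σ 0 = σ 0 * σ 1 * σ 0 * σ 2 := by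
        rw [mul_assoc, ← commute_σ_zero_σ_two.eq, ← mul_assoc]
    _ = σ 1 * δ := by rw [braid_σ_zero_σ_one]; simp only [δ, mul_assoc]

theorem semiconjBy_δ_σ_one : SemiconjBy δ (σ 1) (σ 2) :=
  calc σ 0 * σ 1 * σ 2 * σ 1 = σ 0 * (σ 1 * σ 2 * σ 1) := by simp only [mul_assoc]
    _ = σ 0 * σ 2 * σ 1 * σ 2 := by rw [braid_σ_one_σ_two]; simp only [mul_assoc]
    _ = σ 2 * δ := by rw [commute_σ_zero_σ_two.eq]; simp only [δ, mul_assoc]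

theorem semiconjBy_δ_sq_σ_zero : SemiconjBy (δ ^ 2) (σ 0) (σ 2) :=
  pow_two δ ▸ semiconjBy_δ_σ_one.mul_left semiconjBy_δ_σ_zero

/-- Right multiplication by `τ` rotates a triangle of `X`: its edges are `k`, `kτ` and `kτ²` when
the edges of `X` are indexed by `B₄` modulo its centre `⟨δ⁴⟩`, see `edge`. -/
def τ : B4 := σ 0 * δ

/-- Right multiplication by `θ` takes an edge of a lozenge of `X` to the next one on an oriented
path between the two ends of its short diagonal. -/
def θ : B4 := τ * δ

theorem τ_sq : τ ^ 2 = σ 0 * σ 1 * δ ^ 2 :=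
  calc τ ^ 2 = σ 0 * (δ * σ 0) * δ := by simp only [τ, pow_two, mul_assoc]
    _ = σ 0 * σ 1 * δ ^ 2 := by rw [semiconjBy_δ_σ_zero.eq]; simp only [pow_two, mul_assoc]

theorem τ_pow_three : τ ^ 3 = δ ^ 4 :=
  calc τ ^ 3 = σ 0 * σ 1 * (δ ^ 2 * σ 0) * δ := by
        rw [pow_succ, τ_sq]; simp only [τ, mul_assoc]
    _ = δ * δ ^ 2 * δ := by rw [semiconjBy_δ_sq_σ_zero.eq]; simp only [δ, mul_assoc]
    _ = δ ^ 4 := by rw [← pow_succ', ← pow_succ]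

theorem closure_τ_δ : Subgroup.closure {τ, δ} = (⊤ : Subgroup B4) := by
  set H : Subgroup B4 := Subgroup.closure {τ, δ}
  have mem_δ : δ ∈ H := Subgroup.subset_closure (by simp)
  have mem_of_semiconjBy {x y : B4} (hxy : SemiconjBy δ x y) (hx : x ∈ H) : y ∈ H :=
    eq_mul_inv_of_mul_eq hxy.eq.symm ▸ H.mul_mem (H.mul_mem mem_δ hx) (H.inv_mem mem_δ)
  have mem_σ_zero : σ 0 ∈ H :=
    mul_inv_cancel_right (σ 0) δ ▸
      H.mul_mem (Subgroup.subset_closure (by simp [τ])) (H.inv_mem mem_δ)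
  have mem_σ_one : σ 1 ∈ H := mem_of_semiconjBy semiconjBy_δ_σ_zero mem_σ_zero
  have mem_σ_two : σ 2 ∈ H := mem_of_semiconjBy semiconjBy_δ_σ_one mem_σ_one
  rw [eq_top_iff, ← PresentedGroup.closure_range_of artinRels, Subgroup.closure_le]
  rintro _ ⟨i, rfl⟩
  fin_cases i
  exacts [mem_σ_zero, mem_σ_one, mem_σ_two]

theorem iff_of_mul_right_invariant {P : B4 → Prop} (hτ : ∀ k, P (k * τ) ↔ P k)
    (hδ : ∀ k, P (k * δ) ↔ P k) (g h : B4) : P g ↔ P h := by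
  have invariant (x : B4) : ∀ k, P (k * x) ↔ P k := by
    have hx : x ∈ Subgroup.closure {τ, δ} := closure_τ_δ ▸ Subgroup.mem_top x
    induction hx using Subgroup.closure_induction with
    | mem x hx =>
      rcases hx with rfl | rfl
      exacts [hτ, hδ]
    | one => simp
    | mul x y _ _ ihx ihy => exact fun k => mul_assoc k x y ▸ (ihy _).trans (ihx k)
    | inv x _ ih => exact fun k => by rw [← ih (k * x⁻¹), inv_mul_cancel_right]
  simpa using (invariant (g⁻¹ * h) g).symm

theorem commute_δ_pow_four (x : B4) : Commute (δ ^ 4) x := by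
  have le_centralizer : Subgroup.closure {τ, δ} ≤ Subgroup.centralizer {δ ^ 4} := by
    rw [Subgroup.closure_le]
    rintro _ (rfl | rfl) <;> rw [SetLike.mem_coe, Subgroup.mem_centralizer_singleton_iff]
    · rw [← τ_pow_three, pow_mul_comm']
    · rw [pow_mul_comm']
  rw [closure_τ_δ] at le_centralizer
  exact (Subgroup.mem_centralizer_singleton_iff.1 (le_centralizer (Subgroup.mem_top x))).symm

theorem commute_δ_zpow_four_mul (m : ℤ) (x : B4) : Commute (δ ^ (4 * m)) x := by
  rw [zpow_mul]
  exact Commute.zpow_left (mod_cast commute_δ_pow_four x) m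

theorem semiconjBy_δ_sq_σ_two : SemiconjBy (δ ^ 2) (σ 2) (σ 0) := by
  have h : δ ^ 2 * σ 2 * δ ^ 2 = σ 0 * δ ^ 2 * δ ^ 2 :=
    calc δ ^ 2 * σ 2 * δ ^ 2 = δ ^ 4 * σ 0 := by
          rw [mul_assoc, ← semiconjBy_δ_sq_σ_zero.eq, ← mul_assoc, ← pow_add]
      _ = σ 0 * δ ^ 2 * δ ^ 2 := by rw [(commute_δ_pow_four _).eq, mul_assoc, ← pow_add]
  exact mul_right_cancel h

theorem θ_sq : θ ^ 2 = σ 0 * σ 2 * δ ^ 4 :=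
  calc θ ^ 2 = σ 0 * (δ ^ 2 * σ 0) * δ ^ 2 := by simp only [θ, τ, pow_two, mul_assoc]
    _ = σ 0 * σ 2 * δ ^ 4 := by
      rw [semiconjBy_δ_sq_σ_zero.eq]; simp only [mul_assoc, ← pow_add, Nat.reduceAdd]

theorem commute_δ_sq_θ_sq : Commute (δ ^ 2) (θ ^ 2) := by
  have h : Commute (δ ^ 2) (σ 0 * σ 2) := by
    have := semiconjBy_δ_sq_σ_zero.mul_right semiconjBy_δ_sq_σ_two
    rwa [← commute_σ_zero_σ_two.eq] at this
  exact θ_sq ▸ h.mul_right (commute_δ_pow_four _).symm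

/-- The exponent sum of a braid, as a homomorphism. -/
def lenHom : B4 →* Multiplicative ℤ :=
  PresentedGroup.toGroup (f := fun _ => Multiplicative.ofAdd 1) (by
    rintro r (rfl | rfl | rfl) <;> simp)

/-- The exponent sum of a braid. Modulo `3` it is well defined on the vertices of `X`, and modulo
`12` on its edges. -/
def len (g : B4) : ℤ := (lenHom g).toAdd

theorem len_mul (g h : B4) : len (g * h) = len g + len h := by simp [len]

theorem len_inv (g : B4) : len g⁻¹ = -len g := by simp [len]

theorem len_zpow (g : B4) (n : ℤ) : len (g ^ n) = n * len g := by simp [len]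

theorem len_pow (g : B4) (n : ℕ) : len (g ^ n) = n * len g := by simp [len]

theorem len_σ (i : Fin 3) : len (σ i) = 1 := by simp [len, lenHom, σ, PresentedGroup.toGroup.of]

theorem len_δ : len δ = 3 := by simp [δ, len_mul, len_σ]

theorem len_τ : len τ = 4 := by simp [τ, len_mul, len_σ, len_δ]

theorem len_θ : len θ = 7 := by simp [θ, len_mul, len_τ, len_δ]

/-- The permutation of the strings induced by a braid. With the strings indexed by `ZMod 4`, the
braid `δ` acts as the translation by `1`. -/
def perm : B4 →* Equiv.Perm (ZMod 4) :=
  PresentedGroup.toGroup (f := ![Equiv.swap 0 1, Equiv.swap 1 2, Equiv.swap 2 3]) (by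
    rintro r (rfl | rfl | rfl) <;>
      simp only [map_mul, map_inv, FreeGroup.lift_apply_of] <;> decide)

theorem perm_σ (i : Fin 3) :
    perm (σ i) = ![Equiv.swap 0 1, Equiv.swap 1 2, Equiv.swap 2 3] i :=
  PresentedGroup.toGroup.of _

theorem perm_δ : perm δ = Equiv.addRight 1 := by
  simp only [δ, map_mul, perm_σ]
  decide

theorem perm_δ_zpow (n : ℤ) : perm (δ ^ n) = Equiv.addRight (n : ZMod 4) := by
  rw [map_zpow, perm_δ, Equiv.zsmul_addRight, zsmul_one]

theorem perm_τ : perm τ = Equiv.swap 0 1 * Equiv.addRight 1 := by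
  rw [τ, map_mul, perm_σ, perm_δ]; rfl

theorem perm_θ_sq : perm (θ ^ 2) = Equiv.swap 0 1 * Equiv.swap 2 3 := by
  simp only [θ_sq, map_mul, map_pow, perm_σ, perm_δ]
  decide

theorem commute_δ_zpow_τ_iff {n : ℤ} : Commute (δ ^ n) τ ↔ 4 ∣ n := by
  refine ⟨fun h => ?_, fun ⟨m, hm⟩ => hm ▸ commute_δ_zpow_four_mul m τ⟩
  have h' := h.map perm
  rw [perm_δ_zpow, perm_τ] at h'
  refine (ZMod.intCast_zmod_eq_zero_iff_dvd n 4).1 ?_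
  generalize (n : ZMod 4) = c at h'
  unfold Commute SemiconjBy at h'
  revert c
  decide

theorem commute_δ_zpow_θ_sq_iff {n : ℤ} : Commute (δ ^ n) (θ ^ 2) ↔ 2 ∣ n := by
  refine ⟨fun h => ?_, ?_⟩
  · have h' := h.map perm
    rw [perm_δ_zpow, perm_θ_sq] at h'
    have hn : (n : ZMod 4) = (0 : ℤ) ∨ (n : ZMod 4) = (2 : ℤ) := by
      generalize (n : ZMod 4) = c at h'
      unfold Commute SemiconjBy at h'
      revert c
      decide
    simp only [ZMod.intCast_eq_intCast_iff_dvd_sub] at hn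
    omega
  · rintro ⟨m, rfl⟩
    rw [zpow_mul]
    exact Commute.zpow_left (mod_cast commute_δ_sq_θ_sq) m

theorem τ_mul_δ_zpow_mul_θ_sq_ne (n m : ℤ) : τ * δ ^ n * θ ^ 2 ≠ δ ^ m := by
  intro h
  have hm : m = n + 6 := by
    have := congrArg len h
    simp only [len_mul, len_zpow, len_pow, len_τ, len_δ, len_θ] at this
    omega
  have hperm := congrArg perm h
  simp only [hm, map_mul, perm_τ, perm_δ_zpow, perm_θ_sq, Int.cast_add, Int.cast_ofNat] at hperm
  generalize (n : ZMod 4) = c at hperm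
  revert c
  decide

theorem vtx_eq_iff {g h : B4} : vtx g = vtx h ↔ ∃ n : ℤ, h = g * δ ^ n := by
  simp only [vtx, QuotientGroup.eq, Subgroup.mem_zpowers_iff, eq_inv_mul_iff_mul_eq]
  exact exists_congr fun n => eq_comm

theorem vtx_mul_zpow (g : B4) (n : ℤ) : vtx (g * δ ^ n) = vtx g :=
  (vtx_eq_iff.2 ⟨n, rfl⟩).symm

theorem vtx_mul_pow (g : B4) (n : ℕ) : vtx (g * δ ^ n) = vtx g :=
  mod_cast vtx_mul_zpow g n

theorem vtx_mul_δ (g : B4) : vtx (g * δ) = vtx g := by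
  simpa using vtx_mul_pow g 1

theorem vtx_mul_θ (g : B4) : vtx (g * θ) = vtx (g * τ) := by
  rw [θ, ← mul_assoc, vtx_mul_δ]

theorem three_dvd_len_sub_of_vtx_eq {g h : B4} (hgh : vtx g = vtx h) : 3 ∣ len h - len g := by
  obtain ⟨n, rfl⟩ := vtx_eq_iff.1 hgh
  simp [len_mul, len_zpow, len_δ]

theorem vtx_ne {g h : B4} (hgh : ¬ 3 ∣ len h - len g) : vtx g ≠ vtx h :=
  mt three_dvd_len_sub_of_vtx_eq hgh

theorem segment_eq_iff {x : B4} (hx : ¬ 3 ∣ len x) {k h : B4} :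
    s(vtx k, vtx (k * x)) = s(vtx h, vtx (h * x)) ↔
      ∃ n : ℤ, Commute (δ ^ n) x ∧ h = k * δ ^ n := by
  rw [Sym2.eq_iff]
  constructor
  · rintro (⟨h₁, h₂⟩ | ⟨h₁, h₂⟩)
    · obtain ⟨n, rfl⟩ := vtx_eq_iff.1 h₁
      obtain ⟨m, hm⟩ := vtx_eq_iff.1 h₂
      obtain rfl : n = m := by
        have := congrArg len hm
        simp only [len_mul, len_zpow, len_δ] at this
        omega
      rw [mul_assoc, mul_assoc, mul_right_inj] at hm
      exact ⟨n, hm, rfl⟩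
    · have h₁ := three_dvd_len_sub_of_vtx_eq h₁
      have h₂ := three_dvd_len_sub_of_vtx_eq h₂
      rw [len_mul] at h₁ h₂
      omega
  · rintro ⟨n, hn, rfl⟩
    exact Or.inl ⟨(vtx_mul_zpow _ _).symm, by rw [mul_assoc, hn.eq, ← mul_assoc, vtx_mul_zpow]⟩

/-- The edge `{k⟨δ⟩, kτ⟨δ⟩}` of `X`. By `edge_eq_iff` the edges of `X` correspond to the elements
of `B₄` modulo its centre. -/
def edge (k : B4) : Sym2 Vertex := s(vtx k, vtx (k * τ))

/-- The short diagonal `{k⟨δ⟩, kθ²⟨δ⟩}`. -/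
def diag (k : B4) : Sym2 Vertex := s(vtx k, vtx (k * θ ^ 2))

theorem edge_eq_iff {k h : B4} : edge k = edge h ↔ ∃ m : ℤ, h = k * δ ^ (4 * m) := by
  rw [edge, edge, segment_eq_iff (by rw [len_τ]; norm_num)]
  simp only [commute_δ_zpow_τ_iff, dvd_def, ↓existsAndEq, true_and]

theorem diag_eq_iff {k h : B4} :
    diag k = diag h ↔ edge k = edge h ∨ edge (k * δ ^ 2) = edge h := by
  rw [diag, diag, segment_eq_iff (by rw [len_pow, len_θ]; norm_num)]
  simp only [commute_δ_zpow_θ_sq_iff, edge_eq_iff, mul_assoc]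
  constructor
  · rintro ⟨n, ⟨l, rfl⟩, rfl⟩
    obtain ⟨m, rfl | rfl⟩ := l.even_or_odd'
    · exact Or.inl ⟨m, by rw [← mul_assoc]; rfl⟩
    · exact Or.inr ⟨m, by group⟩
  · rintro (⟨m, rfl⟩ | ⟨m, rfl⟩)
    · exact ⟨4 * m, by omega, rfl⟩
    · exact ⟨2 + 4 * m, by omega, by group⟩

theorem vtx_mul_right {k h : B4} (x : B4) (hkh : edge k = edge h) :
    vtx (k * x) = vtx (h * x) := by
  obtain ⟨m, rfl⟩ := edge_eq_iff.1 hkh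
  rw [mul_assoc, (commute_δ_zpow_four_mul m x).eq, ← mul_assoc, vtx_mul_zpow]

theorem edge_mul_right {k h : B4} (x : B4) (hkh : edge k = edge h) :
    edge (k * x) = edge (h * x) := by
  obtain ⟨m, rfl⟩ := edge_eq_iff.1 hkh
  exact edge_eq_iff.2 ⟨m, by rw [mul_assoc, (commute_δ_zpow_four_mul m x).eq, mul_assoc]⟩

theorem twelve_dvd_len_sub_of_edge_eq {k h : B4} (hkh : edge k = edge h) : 12 ∣ len h - len k := by
  obtain ⟨m, rfl⟩ := edge_eq_iff.1 hkh
  rw [len_mul, len_zpow, len_δ]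
  omega

theorem edge_mul_δ_pow_four (k : B4) : edge (k * δ ^ 4) = edge k :=
  (edge_eq_iff.2 ⟨1, by norm_cast⟩).symm

theorem edge_ne_diag (k h : B4) : edge k ≠ diag h := by
  intro hkh
  rcases Sym2.eq_iff.1 hkh with ⟨h₁, h₂⟩ | ⟨h₁, h₂⟩
  · have h₁ := three_dvd_len_sub_of_vtx_eq h₁
    have h₂ := three_dvd_len_sub_of_vtx_eq h₂
    simp only [len_mul, len_pow, len_τ, len_θ] at h₁ h₂
    omega
  · obtain ⟨n, rfl⟩ := vtx_eq_iff.1 h₂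
    obtain ⟨m, hm⟩ := vtx_eq_iff.1 h₁
    simp only [mul_assoc, mul_right_inj] at hm
    exact τ_mul_δ_zpow_mul_θ_sq_ne n m (by rw [← hm, mul_assoc])

theorem vtx_mem_edge_iff {g k : B4} :
    vtx g ∈ edge k ↔ (∃ n : ℤ, k = g * δ ^ n) ∨ ∃ n : ℤ, k = g * δ ^ n * τ⁻¹ := by
  simp only [edge, Sym2.mem_iff, vtx_eq_iff, eq_mul_inv_iff_mul_eq]

/-- The band generators `a₁₂, a₂₃, a₃₄, a₁₄, a₁₃, a₂₄`. In this order conjugation by `δ` permutes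
them by `bandShift`. -/
def band : Fin 6 → B4 :=
  ![σ 0, σ 1, σ 2, σ 0 * σ 1 * σ 2 * (σ 0 * σ 1)⁻¹, σ 0 * σ 1 * (σ 0)⁻¹, σ 1 * σ 2 * (σ 1)⁻¹]

/-- The permutation of the band generators by conjugation with `δ`, on their indices. -/
def bandShift : Fin 6 → Fin 6 := ![1, 2, 3, 0, 5, 4]

theorem range_band : Set.range band = bandGenerators := by
  ext x
  simp only [Set.mem_range, Fin.exists_fin_succ, bandGenerators, band, Matrix.cons_val_zero,
    Matrix.cons_val_succ, IsEmpty.exists_iff, or_false, Set.mem_insert_iff,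
    Set.mem_singleton_iff, eq_comm (b := x)]
  tauto

theorem band_zero_mul_band_two_mul_band_five : band 0 * band 2 * band 5 = δ :=
  calc σ 0 * σ 2 * (σ 1 * σ 2 * (σ 1)⁻¹) = σ 0 * (σ 2 * σ 1 * σ 2) * (σ 1)⁻¹ := by
        simp only [mul_assoc]
    _ = δ := by rw [← braid_σ_one_σ_two, δ]; group

theorem band_four_mul_band_zero_mul_band_two : band 4 * (band 0 * band 2) = δ := by
  change σ 0 * σ 1 * (σ 0)⁻¹ * (σ 0 * σ 2) = σ 0 * σ 1 * σ 2
  group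

theorem semiconjBy_δ_σ_two : SemiconjBy δ (σ 2) (band 3) := by
  change δ * σ 2 = δ * (σ 0 * σ 1)⁻¹ * δ
  rw [mul_assoc, δ, inv_mul_cancel_left]

theorem semiconjBy_δ_band (i : Fin 6) : SemiconjBy δ (band i) (band (bandShift i)) := by
  fin_cases i
  · exact semiconjBy_δ_σ_zero
  · exact semiconjBy_δ_σ_one
  · exact semiconjBy_δ_σ_two
  · have h := semiconjBy_δ_sq_σ_two.eq
    change δ * band 3 = σ 0 * δ
    rw [← mul_left_inj δ, mul_assoc, ← semiconjBy_δ_σ_two.eq, ← mul_assoc, ← pow_two, h, pow_two,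
      mul_assoc]
  · exact (semiconjBy_δ_σ_zero.mul_right semiconjBy_δ_σ_one).mul_right
      semiconjBy_δ_σ_zero.inv_right
  · change δ * band 5 = band 4 * δ
    conv_lhs => rw [← band_four_mul_band_zero_mul_band_two]
    rw [mul_assoc, band_zero_mul_band_two_mul_band_five]

theorem perm_band (i : Fin 6) :
    perm (band i) = ![Equiv.swap 0 1, Equiv.swap 1 2, Equiv.swap 2 3, Equiv.swap 3 0,
      Equiv.swap 0 2, Equiv.swap 1 3] i := by
  fin_cases i <;> simp only [band, Fin.reduceFinMk, Matrix.cons_val, map_mul, map_inv, perm_σ] <;>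
    decide

/-- The cyclic shift `(x, y, z) ↦ (δzδ⁻¹, x, y)` of the factorizations `xyz = δ` into band
generators, on their indices. -/
def rotate (t : Fin 6 × Fin 6 × Fin 6) : Fin 6 × Fin 6 × Fin 6 := (bandShift t.2.2, t.1, t.2.1)

theorem exists_iterate_rotate_eq {i j l : Fin 6} (h : band i * band j * band l = δ) :
    ∃ n, rotate^[n] (0, 1, 2) = (i, j, l) ∨ rotate^[n] (0, 2, 5) = (i, j, l) := by
  have h' := congrArg perm h
  simp only [map_mul, perm_band, perm_δ] at h'
  suffices ∃ n < 12, rotate^[n] (0, 1, 2) = (i, j, l) ∨ rotate^[n] (0, 2, 5) = (i, j, l) from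
    this.imp fun _ => And.right
  clear h
  revert i j l
  decide

/-- The 2-simplex with the sides `edge k`, `edge (kτ)` and `edge (kτ²)`. -/
def triSimplex (k : B4) : Set Vertex := {vtx k, vtx (k * τ), vtx (k * τ ^ 2)}

/-- The 2-simplex with the sides `edge k`, `edge (kθ)` and `diag k`, one half of a lozenge. -/
def halfSimplex (k : B4) : Set Vertex := {vtx k, vtx (k * θ), vtx (k * θ ^ 2)}

/-- The 2-simplex that starts at `g` and is spanned by the first two of three band generators. -/
def bandSimplex (t : Fin 6 × Fin 6 × Fin 6) (g : B4) : Set Vertex :=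
  {vtx g, vtx (g * band t.1), vtx (g * band t.1 * band t.2.1)}

theorem bandSimplex_zero_one_two (g : B4) : bandSimplex (0, 1, 2) g = triSimplex g := by
  rw [bandSimplex, triSimplex, τ_sq, ← mul_assoc, vtx_mul_pow, τ, ← mul_assoc, vtx_mul_δ, mul_assoc]
  rfl

theorem bandSimplex_zero_two_five (g : B4) : bandSimplex (0, 2, 5) g = halfSimplex g := by
  rw [bandSimplex, halfSimplex, θ_sq, ← mul_assoc, vtx_mul_pow, vtx_mul_θ, τ, ← mul_assoc,
    vtx_mul_δ, mul_assoc]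
  rfl

theorem band_mul_δ_of_mul_mul_eq {i j l : Fin 6} (h : band i * band j * band l = δ) :
    band (bandShift l) * band i * band j = δ := by
  rw [← mul_left_inj (band l), mul_assoc, mul_assoc, ← mul_assoc (band i), h,
    (semiconjBy_δ_band l).eq]

theorem bandSimplex_rotate {i j l : Fin 6} (h : band i * band j * band l = δ) (g : B4) :
    bandSimplex (rotate (i, j, l)) g = bandSimplex (i, j, l) (g * band (bandShift l)) := by
  have h' : vtx (g * band (bandShift l) * band i * band j) = vtx g := by
    rw [mul_assoc, mul_assoc, ← mul_assoc (band _), band_mul_δ_of_mul_mul_eq h, vtx_mul_δ]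
  simp only [bandSimplex, rotate, h']
  rw [Set.insert_comm, Set.pair_comm]

theorem exists_bandSimplex_eq {i j l : Fin 6} (h : band i * band j * band l = δ) (g : B4) :
    ∃ k, bandSimplex (i, j, l) g = triSimplex k ∨ bandSimplex (i, j, l) g = halfSimplex k := by
  let P (t : Fin 6 × Fin 6 × Fin 6) : Prop := band t.1 * band t.2.1 * band t.2.2 = δ ∧
    ∀ g, ∃ k, bandSimplex t g = triSimplex k ∨ bandSimplex t g = halfSimplex k
  have rotate_of t (ht : P t) : P (rotate t) :=
    ⟨band_mul_δ_of_mul_mul_eq ht.1, fun g => bandSimplex_rotate ht.1 g ▸ ht.2 _⟩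
  suffices hP : P (i, j, l) from hP.2 g
  obtain ⟨n, hn | hn⟩ := exists_iterate_rotate_eq h
  · exact hn ▸ Function.Iterate.rec P
      ⟨rfl, fun g => ⟨g, Or.inl (bandSimplex_zero_one_two g)⟩⟩ rotate_of n
  · exact hn ▸ Function.Iterate.rec P
      ⟨band_zero_mul_band_two_mul_band_five, fun g => ⟨g, Or.inr (bandSimplex_zero_two_five g)⟩⟩
      rotate_of n

theorem bandSimplex_mem {i j l : Fin 6} (h : band i * band j * band l = δ) (g : B4) :
    bandSimplex (i, j, l) g ∈ simplices := by
  refine ⟨g, band i, ?_, band j, ?_, band l, ?_, h, rfl⟩ <;>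
    exact range_band ▸ Set.mem_range_self _

theorem mem_simplices_iff {T : Set Vertex} :
    T ∈ simplices ↔ ∃ k, T = triSimplex k ∨ T = halfSimplex k := by
  constructor
  · simp only [simplices, ← range_band]
    rintro ⟨g, _, ⟨i, rfl⟩, _, ⟨j, rfl⟩, _, ⟨l, rfl⟩, h, rfl⟩
    exact exists_bandSimplex_eq h g
  · rintro ⟨k, rfl | rfl⟩
    · rw [← bandSimplex_zero_one_two]
      exact bandSimplex_mem rfl k
    · rw [← bandSimplex_zero_two_five]
      exact bandSimplex_mem band_zero_mul_band_two_mul_band_five k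

theorem sides_triple {A B C : Vertex} (hAB : A ≠ B) (hBC : B ≠ C) (hCA : C ≠ A) :
    sides {A, B, C} = {s(A, B), s(B, C), s(C, A)} := by
  ext e
  induction e with | _ x y
  simp only [sides, Set.mem_ofPred_eq, Sym2.mk_isDiag_iff, Sym2.mem_iff, Set.mem_insert_iff,
    Set.mem_singleton_iff, Sym2.eq_iff, forall_eq_or_imp, forall_eq]
  constructor
  · rintro ⟨h, rfl | rfl | rfl, rfl | rfl | rfl⟩ <;> simp_all
  · rintro ((⟨rfl, rfl⟩ | ⟨rfl, rfl⟩) | (⟨rfl, rfl⟩ | ⟨rfl, rfl⟩) | (⟨rfl, rfl⟩ | ⟨rfl, rfl⟩)) <;>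
      simp_all [eq_comm]

/-- The boundary of the triangle `triSimplex k`. -/
def triangle (k : B4) : Set (Sym2 Vertex) := {edge k, edge (k * τ), edge (k * τ ^ 2)}

/-- The boundary of the lozenge that consists of `halfSimplex k` and `halfSimplex (kδ²)`. -/
def lozenge (k : B4) : Set (Sym2 Vertex) :=
  {edge k, edge (k * θ), edge (k * δ ^ 2), edge (k * δ ^ 2 * θ)}

theorem sides_triSimplex (k : B4) : sides (triSimplex k) = triangle k := by
  have h₁ : edge (k * τ) = s(vtx (k * τ), vtx (k * τ ^ 2)) := by rw [edge, mul_assoc, ← pow_two]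
  have h₂ : edge (k * τ ^ 2) = s(vtx (k * τ ^ 2), vtx k) := by
    rw [edge, mul_assoc, ← pow_succ, τ_pow_three, vtx_mul_pow]
  rw [triSimplex, triangle, h₁, h₂, edge, sides_triple] <;> apply vtx_ne <;>
    simp only [len_mul, len_pow, len_τ] <;> omega

theorem sides_halfSimplex (k : B4) :
    sides (halfSimplex k) = {edge k, edge (k * θ), diag k} := by
  have h : edge (k * θ) = s(vtx (k * θ), vtx (k * θ ^ 2)) := by
    rw [edge, ← vtx_mul_θ, mul_assoc, ← pow_two]
  rw [halfSimplex, h, edge, diag, ← vtx_mul_θ, Sym2.eq_swap (a := vtx k) (b := vtx (k * θ ^ 2)),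
    sides_triple] <;> apply vtx_ne <;>
    simp only [len_mul, len_pow, len_θ] <;> omega

theorem edge_mem_sides_triSimplex_iff {k h : B4} :
    edge k ∈ sides (triSimplex h) ↔ triSimplex h = triSimplex k := by
  have triSimplex_congr {k h : B4} (hkh : edge k = edge h) : triSimplex k = triSimplex h := by
    have h1 := vtx_mul_right 1 hkh
    rw [mul_one, mul_one] at h1
    rw [triSimplex, triSimplex, h1, vtx_mul_right τ hkh, vtx_mul_right (τ ^ 2) hkh]
  have triSimplex_mul_τ (k : B4) : triSimplex (k * τ) = triSimplex k := by
    rw [triSimplex, triSimplex, mul_assoc, ← pow_two, mul_assoc, ← pow_succ', τ_pow_three,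
      vtx_mul_pow, Set.pair_comm, Set.insert_comm, Set.pair_comm]
  refine ⟨?_, fun h => by rw [h, sides_triSimplex]; exact Set.mem_insert _ _⟩
  rw [sides_triSimplex]
  rintro (h | h | h) <;> rw [triSimplex_congr h]
  · rw [triSimplex_mul_τ]
  · rw [pow_two, ← mul_assoc, triSimplex_mul_τ, triSimplex_mul_τ]

theorem edge_mem_triangle_iff {k h : B4} : edge k ∈ triangle h ↔ triangle h = triangle k := by
  constructor
  · rw [← sides_triSimplex, edge_mem_sides_triSimplex_iff, ← sides_triSimplex k]
    exact congrArg sides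
  · exact fun hkh => hkh ▸ Set.mem_insert _ _

theorem halfSimplex_eq_iff {k h : B4} : halfSimplex k = halfSimplex h ↔ edge k = edge h := by
  constructor
  · have edge_eq_or {k h : B4} (hkh : halfSimplex k = halfSimplex h) :
        edge k = edge h ∨ edge k = edge (h * θ) := by
      have hk : edge k ∈ sides (halfSimplex k) := sides_halfSimplex k ▸ Set.mem_insert _ _
      simpa [hkh, sides_halfSimplex, edge_ne_diag] using hk
    intro hkh
    rcases edge_eq_or hkh with hk | hk
    · exact hk
    · rcases edge_eq_or hkh.symm with hh | hh
      · exact hh.symm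
      · have hk := twelve_dvd_len_sub_of_edge_eq hk
        have hh := twelve_dvd_len_sub_of_edge_eq hh
        rw [len_mul, len_θ] at hk hh
        omega
  · intro hkh
    have h1 := vtx_mul_right 1 hkh
    rw [mul_one, mul_one] at h1
    rw [halfSimplex, halfSimplex, h1, vtx_mul_right θ hkh, vtx_mul_right (θ ^ 2) hkh]

theorem edge_mem_sides_halfSimplex_iff {k h : B4} :
    edge k ∈ sides (halfSimplex h) ↔
      halfSimplex h = halfSimplex k ∨ halfSimplex h = halfSimplex (k * θ⁻¹) := by
  have hθ : edge k = edge (h * θ) ↔ edge h = edge (k * θ⁻¹) :=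
    ⟨fun e => by simpa using edge_mul_right θ⁻¹ e.symm, fun e => by
      simpa using edge_mul_right θ e.symm⟩
  simp only [sides_halfSimplex, Set.mem_insert_iff, Set.mem_singleton_iff, edge_ne_diag k, or_false,
    halfSimplex_eq_iff, hθ, eq_comm (a := edge k) (b := edge h)]

theorem diag_mem_sides_halfSimplex_iff {k h : B4} :
    diag k ∈ sides (halfSimplex h) ↔
      halfSimplex h = halfSimplex k ∨ halfSimplex h = halfSimplex (k * δ ^ 2) := by
  simp only [sides_halfSimplex, Set.mem_insert_iff, Set.mem_singleton_iff,
    (edge_ne_diag _ k).symm, false_or, halfSimplex_eq_iff, diag_eq_iff, eq_comm (b := edge h)]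

theorem triSimplex_mem (k : B4) : triSimplex k ∈ simplices := mem_simplices_iff.2 ⟨k, Or.inl rfl⟩

theorem halfSimplex_mem (k : B4) : halfSimplex k ∈ simplices := mem_simplices_iff.2 ⟨k, Or.inr rfl⟩

theorem diag_notMem_triangle (k h : B4) : diag k ∉ triangle h := by
  simp [triangle, (edge_ne_diag _ k).symm]

theorem triSimplex_ne_halfSimplex (k h : B4) : triSimplex k ≠ halfSimplex h := by
  intro hkh
  have hh := diag_mem_sides_halfSimplex_iff.2 (Or.inl (Eq.refl (halfSimplex h)))
  rw [← hkh, sides_triSimplex] at hh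
  exact diag_notMem_triangle h k hh

theorem halfSimplex_mul_ne {x : B4} (hx : ¬ 12 ∣ len x) (k : B4) :
    halfSimplex k ≠ halfSimplex (k * x) := by
  intro h
  have := twelve_dvd_len_sub_of_edge_eq (halfSimplex_eq_iff.1 h)
  rw [len_mul] at this
  omega

theorem setOf_edge_mem_sides (k : B4) :
    {T | T ∈ simplices ∧ edge k ∈ sides T} =
      {triSimplex k, halfSimplex k, halfSimplex (k * θ⁻¹)} := by
  ext T
  constructor
  · rintro ⟨hT, hk⟩
    obtain ⟨h, rfl | rfl⟩ := mem_simplices_iff.1 hT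
    · exact Or.inl (edge_mem_sides_triSimplex_iff.1 hk)
    · exact Or.inr (edge_mem_sides_halfSimplex_iff.1 hk)
  · rintro (rfl | rfl | rfl)
    · exact ⟨triSimplex_mem _, edge_mem_sides_triSimplex_iff.2 rfl⟩
    · exact ⟨halfSimplex_mem _, edge_mem_sides_halfSimplex_iff.2 (Or.inl rfl)⟩
    · exact ⟨halfSimplex_mem _, edge_mem_sides_halfSimplex_iff.2 (Or.inr rfl)⟩

theorem setOf_diag_mem_sides (k : B4) :
    {T | T ∈ simplices ∧ diag k ∈ sides T} = {halfSimplex k, halfSimplex (k * δ ^ 2)} := by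
  ext T
  constructor
  · rintro ⟨hT, hk⟩
    obtain ⟨h, rfl | rfl⟩ := mem_simplices_iff.1 hT
    · exact absurd (sides_triSimplex h ▸ hk) (diag_notMem_triangle k h)
    · exact diag_mem_sides_halfSimplex_iff.1 hk
  · rintro (rfl | rfl)
    · exact ⟨halfSimplex_mem _, diag_mem_sides_halfSimplex_iff.2 (Or.inl rfl)⟩
    · exact ⟨halfSimplex_mem _, diag_mem_sides_halfSimplex_iff.2 (Or.inr rfl)⟩

theorem order_edge (k : B4) : order (edge k) = 3 := by
  rw [order, setOf_edge_mem_sides, Set.encard_eq_three]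
  exact ⟨_, _, _, triSimplex_ne_halfSimplex _ _, triSimplex_ne_halfSimplex _ _,
    halfSimplex_mul_ne (by rw [len_inv, len_θ]; norm_num) k, rfl⟩

theorem order_diag (k : B4) : order (diag k) = 2 := by
  rw [order, setOf_diag_mem_sides,
    Set.encard_pair (halfSimplex_mul_ne (by rw [len_pow, len_δ]; norm_num) k)]

theorem exists_eq_edge_or_diag {T : Set Vertex} {e : Sym2 Vertex} (hT : T ∈ simplices)
    (he : e ∈ sides T) : ∃ k, e = edge k ∨ e = diag k := by
  obtain ⟨k, rfl | rfl⟩ := mem_simplices_iff.1 hT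
  · rw [sides_triSimplex] at he
    rcases he with rfl | rfl | rfl <;> exact ⟨_, Or.inl rfl⟩
  · rw [sides_halfSimplex] at he
    rcases he with rfl | rfl | rfl
    exacts [⟨_, Or.inl rfl⟩, ⟨_, Or.inl rfl⟩, ⟨_, Or.inr rfl⟩]

theorem mem_edges_iff {e : Sym2 Vertex} : e ∈ edges ↔ ∃ k, e = edge k := by
  refine ⟨fun he => ?_, fun ⟨k, hk⟩ => hk ▸ order_edge k⟩
  have he : order e = 3 := he
  obtain ⟨T, hT, heT⟩ : {T | T ∈ simplices ∧ e ∈ sides T}.Nonempty :=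
    Set.encard_pos.1 (show 0 < order e by rw [he]; norm_num)
  obtain ⟨k, rfl | rfl⟩ := exists_eq_edge_or_diag hT heT
  · exact ⟨k, rfl⟩
  · simp [order_diag] at he

theorem isTriangle_iff {f : Set (Sym2 Vertex)} : IsTriangle f ↔ ∃ k, f = triangle k := by
  constructor
  · rintro ⟨T, hT, hsides, rfl⟩
    obtain ⟨k, rfl | rfl⟩ := mem_simplices_iff.1 hT
    · exact ⟨k, sides_triSimplex k⟩
    · obtain ⟨h, hh⟩ := mem_edges_iff.1
        (hsides (diag_mem_sides_halfSimplex_iff.2 (Or.inl (Eq.refl (halfSimplex k)))))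
      exact absurd hh.symm (edge_ne_diag h k)
  · rintro ⟨k, rfl⟩
    refine ⟨_, triSimplex_mem k, ?_, (sides_triSimplex k).symm⟩
    rw [sides_triSimplex]
    rintro e (rfl | rfl | rfl) <;> exact mem_edges_iff.2 ⟨_, rfl⟩

theorem sides_halfSimplex_union_sdiff_diag (k : B4) :
    (sides (halfSimplex k) ∪ sides (halfSimplex (k * δ ^ 2))) \ {diag k} = lozenge k := by
  have hdiag : diag (k * δ ^ 2) = diag k := (diag_eq_iff.2 (Or.inr rfl)).symm
  ext e
  simp only [sides_halfSimplex, hdiag, lozenge, Set.mem_sdiff, Set.mem_union, Set.mem_insert_iff,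
    Set.mem_singleton_iff]
  constructor
  · tauto
  · rintro (rfl | rfl | rfl | rfl) <;> exact ⟨by tauto, edge_ne_diag _ _⟩

theorem isLozenge_iff {f : Set (Sym2 Vertex)} : IsLozenge f ↔ ∃ k, f = lozenge k := by
  constructor
  · rintro ⟨T, hT, T', hT', d, hne, hd, hd', horder, rfl⟩
    obtain ⟨k, rfl | rfl⟩ := exists_eq_edge_or_diag hT hd
    · simp [order_edge] at horder
    · refine ⟨k, ?_⟩
      rw [← sides_halfSimplex_union_sdiff_diag]
      have hT : T ∈ ({halfSimplex k, halfSimplex (k * δ ^ 2)} : Set _) :=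
        setOf_diag_mem_sides k ▸ ⟨hT, hd⟩
      have hT' : T' ∈ ({halfSimplex k, halfSimplex (k * δ ^ 2)} : Set _) :=
        setOf_diag_mem_sides k ▸ ⟨hT', hd'⟩
      rcases hT with rfl | rfl <;> rcases hT' with rfl | rfl
      exacts [absurd rfl hne, rfl, by rw [Set.union_comm], absurd rfl hne]
  · rintro ⟨k, rfl⟩
    exact ⟨_, halfSimplex_mem k, _, halfSimplex_mem (k * δ ^ 2), diag k,
      halfSimplex_mul_ne (by rw [len_pow, len_δ]; norm_num) k,
      diag_mem_sides_halfSimplex_iff.2 (Or.inl rfl), diag_mem_sides_halfSimplex_iff.2 (Or.inr rfl),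
      order_diag k, (sides_halfSimplex_union_sdiff_diag k).symm⟩

theorem mem_faces_iff {f : Set (Sym2 Vertex)} :
    f ∈ faces ↔ (∃ k, f = triangle k) ∨ ∃ k, f = lozenge k :=
  or_congr isTriangle_iff isLozenge_iff

theorem triangle_mul_τ_inv (k : B4) : triangle (k * τ⁻¹) = triangle k :=
  edge_mem_triangle_iff.1 (Or.inr (Or.inl (by rw [inv_mul_cancel_right])))

theorem triangle_congr {k h : B4} (hkh : edge k = edge h) : triangle k = triangle h := by
  simp only [triangle, hkh, edge_mul_right _ hkh]

theorem lozenge_congr {k h : B4} (hkh : edge k = edge h) : lozenge k = lozenge h := by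
  simp only [lozenge, mul_assoc, hkh, edge_mul_right _ hkh]

theorem lozenge_mul_δ_sq (k : B4) : lozenge (k * δ ^ 2) = lozenge k := by
  have h : edge (k * δ ^ 2 * δ ^ 2) = edge k := by rw [mul_assoc, ← pow_add, edge_mul_δ_pow_four]
  rw [lozenge, lozenge, edge_mul_right θ h, h]
  ext e
  simp only [Set.mem_insert_iff, Set.mem_singleton_iff]
  tauto

theorem lozenge_mul_δ_zpow_two_mul (k : B4) (m : ℤ) :
    lozenge (k * δ ^ (2 * m)) = lozenge k := by
  have hperiodic : Function.Periodic (fun n : ℤ => lozenge (k * δ ^ n)) 2 := fun n => by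
    simpa only [zpow_add, ← mul_assoc] using mod_cast lozenge_mul_δ_sq (k * δ ^ n)
  simpa [mul_comm] using hperiodic.int_mul m 0

theorem edge_mem_lozenge_iff {k h : B4} :
    edge k ∈ lozenge h ↔ lozenge h = lozenge k ∨ lozenge h = lozenge (k * θ⁻¹) := by
  have lozenge_eq_of_edge_eq_mul_θ {h : B4} (hk : edge k = edge (h * θ)) :
      lozenge h = lozenge (k * θ⁻¹) :=
    lozenge_congr (by simpa using edge_mul_right θ⁻¹ hk.symm)
  constructor
  · rintro (hk | hk | hk | hk)
    · exact Or.inl (lozenge_congr hk.symm)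
    · exact Or.inr (lozenge_eq_of_edge_eq_mul_θ hk)
    · exact Or.inl (by rw [← lozenge_mul_δ_sq, lozenge_congr hk])
    · exact Or.inr (by rw [← lozenge_mul_δ_sq, lozenge_eq_of_edge_eq_mul_θ hk])
  · rintro (hh | hh) <;> rw [hh]
    · exact Or.inl rfl
    · exact Or.inr (Or.inl (by rw [inv_mul_cancel_right]))

theorem four_dvd_len_sub_of_edge_mem_triangle {k h : B4} (hk : edge k ∈ triangle h) :
    4 ∣ len k - len h := by
  have hlen := Or.imp twelve_dvd_len_sub_of_edge_eq
    (Or.imp twelve_dvd_len_sub_of_edge_eq twelve_dvd_len_sub_of_edge_eq) hk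
  simp only [len_mul, len_pow, len_τ, Nat.cast_ofNat] at hlen
  omega

theorem six_dvd_len_sub_or_of_edge_mem_lozenge {k h : B4} (hk : edge k ∈ lozenge h) :
    6 ∣ len k - len h ∨ 6 ∣ len k - len h - 1 := by
  have hlen := Or.imp twelve_dvd_len_sub_of_edge_eq
    (Or.imp twelve_dvd_len_sub_of_edge_eq
      (Or.imp twelve_dvd_len_sub_of_edge_eq twelve_dvd_len_sub_of_edge_eq)) hk
  simp only [len_mul, len_pow, len_θ, len_δ, Nat.cast_ofNat] at hlen
  omega

theorem six_dvd_len_sub_of_lozenge_eq {k h : B4} (hkh : lozenge k = lozenge h) :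
    6 ∣ len k - len h := by
  have hk := six_dvd_len_sub_or_of_edge_mem_lozenge (edge_mem_lozenge_iff.2 (Or.inl hkh.symm))
  have hh := six_dvd_len_sub_or_of_edge_mem_lozenge (edge_mem_lozenge_iff.2 (Or.inl hkh))
  omega

theorem lozenge_ne_mul_θ_inv (k : B4) : lozenge k ≠ lozenge (k * θ⁻¹) := by
  intro h
  have := six_dvd_len_sub_of_lozenge_eq h
  rw [len_mul, len_inv, len_θ] at this
  omega

theorem triangle_ne_lozenge (k h : B4) : triangle k ≠ lozenge h := by
  intro hkh
  have hh : edge h ∈ triangle k := hkh ▸ Or.inl rfl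
  have hhθ : edge (h * θ) ∈ triangle k := hkh ▸ Or.inr (Or.inl rfl)
  have hh := four_dvd_len_sub_of_edge_mem_triangle hh
  have hhθ := four_dvd_len_sub_of_edge_mem_triangle hhθ
  rw [len_mul, len_θ] at hhθ
  omega

theorem setOf_edge_mem_faces (k : B4) :
    {f | f ∈ faces ∧ edge k ∈ f} = {triangle k, lozenge k, lozenge (k * θ⁻¹)} := by
  ext f
  constructor
  · rintro ⟨hf, hk⟩
    rcases mem_faces_iff.1 hf with ⟨h, rfl⟩ | ⟨h, rfl⟩
    · exact Or.inl (edge_mem_triangle_iff.1 hk)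
    · exact Or.inr (edge_mem_lozenge_iff.1 hk)
  · rintro (rfl | rfl | rfl)
    · exact ⟨mem_faces_iff.2 (Or.inl ⟨_, rfl⟩), edge_mem_triangle_iff.2 rfl⟩
    · exact ⟨mem_faces_iff.2 (Or.inr ⟨_, rfl⟩), edge_mem_lozenge_iff.2 (Or.inl rfl)⟩
    · exact ⟨mem_faces_iff.2 (Or.inr ⟨_, rfl⟩), edge_mem_lozenge_iff.2 (Or.inr rfl)⟩

theorem encard_inter_triple_eq_two_iff {α : Type*} {S : Set α} {a b c : α} (hab : a ≠ b)
    (hac : a ≠ c) (hbc : b ≠ c) :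
    (S ∩ {a, b, c}).encard = 2 ↔
      a ∉ S ∧ b ∈ S ∧ c ∈ S ∨ a ∈ S ∧ b ∉ S ∧ c ∈ S ∨ a ∈ S ∧ b ∈ S ∧ c ∉ S := by
  by_cases ha : a ∈ S <;> by_cases hb : b ∈ S <;> by_cases hc : c ∈ S <;>
    simp [ha, hb, hc, Set.inter_insert_of_mem, Set.inter_insert_of_notMem,
      Set.inter_singleton_of_mem, Set.encard_insert_of_notMem, hab, hac, hbc] <;>
    norm_num

variable {S : Set (Set (Sym2 Vertex))}

theorem encard_faces_eq_two_iff (hS : S ⊆ faces) (k : B4) :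
    {f | f ∈ S ∧ edge k ∈ f}.encard = 2 ↔
      triangle k ∉ S ∧ lozenge k ∈ S ∧ lozenge (k * θ⁻¹) ∈ S ∨
      triangle k ∈ S ∧ lozenge k ∉ S ∧ lozenge (k * θ⁻¹) ∈ S ∨
      triangle k ∈ S ∧ lozenge k ∈ S ∧ lozenge (k * θ⁻¹) ∉ S := by
  have h : {f | f ∈ S ∧ edge k ∈ f} = S ∩ {triangle k, lozenge k, lozenge (k * θ⁻¹)} := by
    rw [← setOf_edge_mem_faces]
    ext f
    exact ⟨fun hf => ⟨hf.1, hS hf.1, hf.2⟩, fun hf => ⟨hf.1, hf.2.2⟩⟩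
  rw [h, encard_inter_triple_eq_two_iff (triangle_ne_lozenge _ _) (triangle_ne_lozenge _ _)
    (lozenge_ne_mul_θ_inv k)]

theorem edge_mem_edges (k : B4) : edge k ∈ edges := mem_edges_iff.2 ⟨k, rfl⟩

theorem vtx_mem_edge_mul_zpow (g : B4) (n : ℤ) : vtx g ∈ edge (g * δ ^ n) :=
  vtx_mem_edge_iff.2 (Or.inl ⟨n, rfl⟩)

theorem vtx_mem_edge_mul_zpow_mul_τ_inv (g : B4) (n : ℤ) : vtx g ∈ edge (g * δ ^ n * τ⁻¹) :=
  vtx_mem_edge_iff.2 (Or.inr ⟨n, rfl⟩)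

theorem three_dvd_len_sub_or_of_vtx_mem_edge {g k : B4} (hk : vtx g ∈ edge k) :
    3 ∣ len k - len g ∨ 3 ∣ len k - len g + 1 := by
  rcases vtx_mem_edge_iff.1 hk with ⟨n, rfl⟩ | ⟨n, rfl⟩ <;>
    simp only [len_mul, len_inv, len_zpow, len_δ, len_τ] <;> omega

theorem link_induction {v : Vertex} (hlink : (link S v).Connected) {P : B4 → Prop}
    (hP : ∀ k h, edge k = edge h → P k → P h)
    (step : ∀ f ∈ S, ∀ k h, edge k ∈ f → edge h ∈ f → v ∈ edge k → v ∈ edge h → P k → P h)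
    {k h : B4} (hk : v ∈ edge k) (hh : v ∈ edge h) (hPk : P k) : P h := by
  have hreach := (SimpleGraph.reachable_iff_reflTransGen _ _).1
    (hlink.preconnected ⟨edge k, edge_mem_edges k, hk⟩ ⟨edge h, edge_mem_edges h, hh⟩)
  suffices ∀ x, Relation.ReflTransGen (link S v).Adj ⟨edge k, edge_mem_edges k, hk⟩ x →
      ∀ h, x.1 = edge h → P h from this _ hreach h rfl
  intro x hx
  induction hx with
  | refl => exact fun h hkh => hP k h hkh hPk
  | @tail x y _ hxy ih =>
    intro h hyh
    obtain ⟨-, f, hf, hxf, hyf⟩ := hxy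
    obtain ⟨j, hj⟩ := mem_edges_iff.1 x.2.1
    exact step f hf j h (hj ▸ hxf) (hyh ▸ hyf) (hj ▸ x.2.2) (hyh ▸ y.2.2) (ih j hj)

theorem exists_triangle_mem (hS : IsHamiltonianSurface S) (g : B4) :
    ∃ n : ℤ, triangle (g * δ ^ n) ∈ S := by
  by_contra! htri
  -- A corner of a lozenge at `vtx g` joins two edges in this class or two edges outside it.
  let P : B4 → Prop := fun k => (len k - len g) % 6 = 0 ∨ (len k - len g) % 6 = 5
  have hP k h (hkh : edge k = edge h) : P k → P h := by
    have := twelve_dvd_len_sub_of_edge_eq hkh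
    omega
  suffices hg : P (g * δ ^ (1 : ℤ)) by
    simp only [P, len_mul, len_zpow, len_δ] at hg
    omega
  refine link_induction (hS.link_connected (vtx g)) hP ?_ (vtx_mem_edge_mul_zpow g 0)
    (vtx_mem_edge_mul_zpow g 1) (by simp [P])
  intro f hf k h hk hh hvk hvh
  rcases mem_faces_iff.1 (hS.subset_faces hf) with ⟨j, rfl⟩ | ⟨j, rfl⟩
  · rw [edge_mem_triangle_iff.1 hk] at hf
    rcases vtx_mem_edge_iff.1 hvk with ⟨n, rfl⟩ | ⟨n, rfl⟩
    · exact absurd hf (htri n)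
    · exact absurd hf (triangle_mul_τ_inv (g * δ ^ n) ▸ htri n)
  · have hk := six_dvd_len_sub_or_of_edge_mem_lozenge hk
    have hh := six_dvd_len_sub_or_of_edge_mem_lozenge hh
    have hvk := three_dvd_len_sub_or_of_vtx_mem_edge hvk
    have hvh := three_dvd_len_sub_or_of_vtx_mem_edge hvh
    omega

theorem exists_lozenge_mul_τ_inv_mem (hS : IsHamiltonianSurface S) (g : B4) :
    ∃ n : ℤ, lozenge (g * δ ^ n * τ⁻¹) ∈ S := by
  by_contra! hacute
  -- The lozenge of `g δⁿ τ⁻¹` has an acute corner at `g⟨δ⟩`; triangles and obtuse corners join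
  -- edges of equal parity.
  let P : B4 → Prop := fun k => Even (len k - len g)
  have hP k h (hkh : edge k = edge h) : P k → P h := by
    have := twelve_dvd_len_sub_of_edge_eq hkh
    simp only [P, Int.even_iff]
    omega
  suffices hg : P (g * δ ^ (1 : ℤ)) by
    simp only [P, len_mul, len_zpow, len_δ, Int.even_iff] at hg
    omega
  refine link_induction (hS.link_connected (vtx g)) hP ?_ (vtx_mem_edge_mul_zpow g 0)
    (vtx_mem_edge_mul_zpow g 1) (by simp [P])
  intro f hf k h hk hh hvk hvh
  simp only [P, Int.even_iff]
  rcases mem_faces_iff.1 (hS.subset_faces hf) with ⟨j, rfl⟩ | ⟨j, rfl⟩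
  · have hk := four_dvd_len_sub_of_edge_mem_triangle hk
    have hh := four_dvd_len_sub_of_edge_mem_triangle hh
    omega
  · have hlen {k : B4} (hk : edge k ∈ lozenge j) (hvk : vtx g ∈ edge k) :
        6 ∣ len j - len k ∧ 3 ∣ len k - len g ∨ 6 ∣ len j - len (k * θ⁻¹) := by
      rcases edge_mem_lozenge_iff.1 hk with hjk | hjk
      · refine Or.inl ⟨six_dvd_len_sub_of_lozenge_eq hjk, ?_⟩
        rcases vtx_mem_edge_iff.1 hvk with ⟨n, rfl⟩ | ⟨n, rfl⟩
        · simp [len_mul, len_zpow, len_δ]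
        · exact absurd (hjk ▸ hf) (hacute n)
      · exact Or.inr (six_dvd_len_sub_of_lozenge_eq hjk)
    have hk := hlen hk hvk
    have hh := hlen hh hvh
    have hvk := three_dvd_len_sub_or_of_vtx_mem_edge hvk
    have hvh := three_dvd_len_sub_or_of_vtx_mem_edge hvh
    simp only [len_mul, len_inv, len_θ] at hk hh
    omega

theorem IsEnvelopingSurface.exactly_two_mem (hS : IsEnvelopingSurface S) (k : B4) :
    triangle k ∉ S ∧ lozenge k ∈ S ∧ lozenge (k * θ⁻¹) ∈ S ∨
    triangle k ∈ S ∧ lozenge k ∉ S ∧ lozenge (k * θ⁻¹) ∈ S ∨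
    triangle k ∈ S ∧ lozenge k ∈ S ∧ lozenge (k * θ⁻¹) ∉ S :=
  (encard_faces_eq_two_iff hS.subset_faces k).1 (hS.two_faces _ (edge_mem_edges k))

theorem exactly_two_mem_mul_δ (hS : IsEnvelopingSurface S) (k : B4) :
    triangle (k * δ) ∉ S ∧ lozenge (k * δ) ∈ S ∧ lozenge (k * τ⁻¹) ∈ S ∨
    triangle (k * δ) ∈ S ∧ lozenge (k * δ) ∉ S ∧ lozenge (k * τ⁻¹) ∈ S ∨
    triangle (k * δ) ∈ S ∧ lozenge (k * δ) ∈ S ∧ lozenge (k * τ⁻¹) ∉ S := by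
  have h : k * δ * θ⁻¹ = k * τ⁻¹ := by rw [θ]; group
  exact h ▸ hS.exactly_two_mem (k * δ)

theorem lozenge_mul_δ_notMem (hS : IsHamiltonianSurface S) {k : B4} (hk : lozenge k ∈ S) :
    lozenge (k * δ) ∉ S := by
  intro hkδ
  have lozenge_mem (n : ℤ) : lozenge (k * δ ^ n) ∈ S := by
    obtain ⟨m, rfl | rfl⟩ := n.even_or_odd'
    · rwa [lozenge_mul_δ_zpow_two_mul]
    · rwa [add_comm, zpow_one_add, ← mul_assoc, lozenge_mul_δ_zpow_two_mul]
  have triangle_notMem_succ {n : ℤ} (hn : lozenge (k * δ ^ n * τ⁻¹) ∈ S) :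
      triangle (k * δ ^ (n + 1)) ∉ S := by
    have hedge := exactly_two_mem_mul_δ hS.toIsEnvelopingSurface (k * δ ^ n)
    have hlozenge := lozenge_mem (n + 1)
    rw [zpow_add_one, ← mul_assoc] at hlozenge ⊢
    tauto
  have triangle_notMem_step {n : ℤ} (hn : triangle (k * δ ^ n) ∉ S) :
      triangle (k * δ ^ (n + 1)) ∉ S := by
    have hedge := hS.exactly_two_mem (k * δ ^ n * τ⁻¹)
    rw [triangle_mul_τ_inv] at hedge
    exact triangle_notMem_succ (by tauto)
  -- Now an acute corner at `k⟨δ⟩` excludes the next triangle there, which forces the next acute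
  -- corner, and so on around the vertex; but some triangle at `k⟨δ⟩` is present.
  obtain ⟨m, hm⟩ := exists_lozenge_mul_τ_inv_mem hS k
  obtain ⟨n, hn⟩ := exists_triangle_mem hS k
  have triangle_notMem (i : ℕ) : triangle (k * δ ^ (m + 1 + i)) ∉ S := by
    induction i with
    | zero => simpa using triangle_notMem_succ hm
    | succ i ih => simpa [add_assoc] using triangle_notMem_step ih
  obtain ⟨i, l, hil⟩ : ∃ (i : ℕ) (l : ℤ), m + 1 + i = n + 4 * l :=
    ⟨((n - m - 1) % 4).toNat, -((n - m - 1) / 4), by omega⟩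
  have hedge : edge (k * δ ^ n) = edge (k * δ ^ (m + 1 + i : ℤ)) :=
    edge_eq_iff.2 ⟨l, by rw [hil, zpow_add, mul_assoc]⟩
  exact triangle_notMem i (triangle_congr hedge ▸ hn)

theorem lozenge_mul_τ_inv_mem (hS : IsHamiltonianSurface S) {k : B4} (hk : lozenge k ∈ S) :
    lozenge (k * τ⁻¹) ∈ S := by
  have hkδ := lozenge_mul_δ_notMem hS hk
  have hedge := exactly_two_mem_mul_δ hS.toIsEnvelopingSurface k
  tauto

theorem lozenge_mul_τ_mem_iff (hS : IsHamiltonianSurface S) (k : B4) :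
    lozenge (k * τ) ∈ S ↔ lozenge k ∈ S := by
  constructor
  · intro hk
    simpa using lozenge_mul_τ_inv_mem hS hk
  · intro hk
    have h : k * τ = k * δ ^ 4 * τ⁻¹ * τ⁻¹ := by rw [← τ_pow_three]; group
    rw [← lozenge_congr (edge_mul_δ_pow_four k)] at hk
    exact h ▸ lozenge_mul_τ_inv_mem hS (lozenge_mul_τ_inv_mem hS hk)

theorem triangle_mem (hS : IsHamiltonianSurface S) (k : B4) : triangle k ∈ S := by
  have hδ := lozenge_mul_δ_notMem hS (k := k * δ⁻¹)
  have hτ := lozenge_mul_τ_mem_iff hS (k * δ⁻¹ * τ⁻¹)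
  have hedge := exactly_two_mem_mul_δ hS.toIsEnvelopingSurface (k * δ⁻¹)
  rw [inv_mul_cancel_right] at hδ hτ hedge
  tauto

theorem lozenge_mul_δ_mem_iff (hS : IsHamiltonianSurface S) (k : B4) :
    lozenge (k * δ) ∈ S ↔ lozenge k ∉ S := by
  have hkδ := lozenge_mul_δ_notMem hS (k := k)
  have hτ := lozenge_mul_τ_mem_iff hS (k * τ⁻¹)
  rw [inv_mul_cancel_right] at hτ
  have hedge := exactly_two_mem_mul_δ hS.toIsEnvelopingSurface k
  tauto

theorem lozenge_mem_iff (hS : IsHamiltonianSurface S) {g : B4} (hg : lozenge g ∈ S) (k : B4) :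
    lozenge k ∈ S ↔ Even (len k - len g) := by
  have invariant_τ (k : B4) : (lozenge (k * τ) ∈ S ↔ Even (len (k * τ) - len g)) ↔
      (lozenge k ∈ S ↔ Even (len k - len g)) := by
    have hlen : Even (len (k * τ) - len g) ↔ Even (len k - len g) := by
      rw [len_mul, len_τ, Int.even_iff, Int.even_iff]
      omega
    rw [lozenge_mul_τ_mem_iff hS, hlen]
  have invariant_δ (k : B4) : (lozenge (k * δ) ∈ S ↔ Even (len (k * δ) - len g)) ↔
      (lozenge k ∈ S ↔ Even (len k - len g)) := by
    have hlen : Even (len (k * δ) - len g) ↔ ¬ Even (len k - len g) := by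
      rw [len_mul, len_δ, Int.even_iff, Int.even_iff]
      omega
    rw [lozenge_mul_δ_mem_iff hS, hlen, not_iff_not]
  exact (iff_of_mul_right_invariant (P := fun k => lozenge k ∈ S ↔ Even (len k - len g))
    invariant_τ invariant_δ g k).1 (by simpa using hg)

/-- The surface formed by all triangles of `X` and the lozenges of the parity of `lozenge g`. By
`six_dvd_len_sub_of_lozenge_eq` the parity of the exponent sum is well defined on lozenges. -/
def paritySurface (g : B4) : Set (Set (Sym2 Vertex)) :=
  {f | (∃ k, f = triangle k) ∨ ∃ k, Even (len k - len g) ∧ f = lozenge k}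

theorem triangle_mem_paritySurface (g k : B4) : triangle k ∈ paritySurface g := Or.inl ⟨k, rfl⟩

theorem lozenge_mem_paritySurface {g k : B4} :
    lozenge k ∈ paritySurface g ↔ Even (len k - len g) := by
  refine ⟨?_, fun hk => Or.inr ⟨k, hk, rfl⟩⟩
  rintro (⟨h, hkh⟩ | ⟨h, hh, hkh⟩)
  · exact absurd hkh.symm (triangle_ne_lozenge h k)
  · have := six_dvd_len_sub_of_lozenge_eq hkh
    rw [Int.even_iff] at hh ⊢
    omega

theorem eq_paritySurface (hS : IsHamiltonianSurface S) {g : B4} (hg : lozenge g ∈ S) :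
    S = paritySurface g := by
  ext f
  constructor
  · intro hf
    rcases mem_faces_iff.1 (hS.subset_faces hf) with ⟨k, rfl⟩ | ⟨k, rfl⟩
    · exact triangle_mem_paritySurface g k
    · exact lozenge_mem_paritySurface.2 ((lozenge_mem_iff hS hg k).1 hf)
  · rintro (⟨k, rfl⟩ | ⟨k, hk, rfl⟩)
    · exact triangle_mem hS k
    · exact (lozenge_mem_iff hS hg k).2 hk

theorem paritySurface_subset_faces (g : B4) : paritySurface g ⊆ faces := fun _ hf =>
  mem_faces_iff.2 (hf.imp_right fun ⟨k, _, hk⟩ => ⟨k, hk⟩)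

theorem encard_paritySurface_faces_eq_two (g : B4) {e : Sym2 Vertex} (he : e ∈ edges) :
    {f | f ∈ paritySurface g ∧ e ∈ f}.encard = 2 := by
  obtain ⟨k, rfl⟩ := mem_edges_iff.1 he
  rw [encard_faces_eq_two_iff (paritySurface_subset_faces g)]
  have htriangle := triangle_mem_paritySurface g k
  have hlozenge : lozenge (k * θ⁻¹) ∈ paritySurface g ↔ lozenge k ∉ paritySurface g := by
    rw [lozenge_mem_paritySurface, lozenge_mem_paritySurface, len_mul, len_inv, len_θ,
      Int.even_iff, Int.even_iff]
    omega
  tauto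

/-- The edge `{w⟨δ⟩, wδⁿτ⟨δ⟩}` as a vertex of the link at `w⟨δ⟩`. -/
def outEdge (w : B4) (n : ℤ) : {e : Sym2 Vertex // e ∈ edges ∧ vtx w ∈ e} :=
  ⟨edge (w * δ ^ n), edge_mem_edges _, vtx_mem_edge_mul_zpow w n⟩

/-- The edge `{wδⁿτ⁻¹⟨δ⟩, w⟨δ⟩}` as a vertex of the link at `w⟨δ⟩`. -/
def inEdge (w : B4) (n : ℤ) : {e : Sym2 Vertex // e ∈ edges ∧ vtx w ∈ e} :=
  ⟨edge (w * δ ^ n * τ⁻¹), edge_mem_edges _, vtx_mem_edge_mul_zpow_mul_τ_inv w n⟩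

theorem link_reachable_of_mem_face {v : Vertex} {f : Set (Sym2 Vertex)} (hf : f ∈ S)
    {x y : {e : Sym2 Vertex // e ∈ edges ∧ v ∈ e}} (hx : x.1 ∈ f) (hy : y.1 ∈ f) :
    (link S v).Reachable x y := by
  rcases eq_or_ne x y with rfl | hxy
  · rfl
  · exact SimpleGraph.Adj.reachable ⟨hxy, f, hf, hx, hy⟩

theorem link_reachable_inEdge_outEdge (g w : B4) (n : ℤ) :
    (link (paritySurface g) (vtx w)).Reachable (inEdge w n) (outEdge w n) :=
  link_reachable_of_mem_face (triangle_mem_paritySurface g (w * δ ^ n))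
    (edge_mem_triangle_iff.2 (triangle_mul_τ_inv _).symm) (edge_mem_triangle_iff.2 rfl)

theorem link_reachable_outEdge_add_two {g w : B4} (hw : Even (len w - len g)) (m : ℤ) :
    (link (paritySurface g) (vtx w)).Reachable (outEdge w (2 * m)) (outEdge w (2 * (m + 1))) := by
  have hlozenge : lozenge (w * δ ^ (2 * m)) ∈ paritySurface g := by
    rwa [lozenge_mul_δ_zpow_two_mul, lozenge_mem_paritySurface]
  have h : w * δ ^ (2 * m) * δ ^ 2 = w * δ ^ (2 * (m + 1)) := by group
  exact link_reachable_of_mem_face hlozenge (Or.inl rfl)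
    (Or.inr (Or.inr (Or.inl (congrArg edge h.symm))))

theorem link_reachable_inEdge_outEdge_add_one {g w : B4} (hw : Even (len w - len g)) (m : ℤ) :
    (link (paritySurface g) (vtx w)).Reachable (inEdge w (2 * m)) (outEdge w (2 * m + 1)) := by
  have hlozenge : lozenge (w * δ ^ (2 * m) * τ⁻¹) ∈ paritySurface g := by
    rw [lozenge_mem_paritySurface, Int.even_iff]
    rw [Int.even_iff] at hw
    simp only [len_mul, len_inv, len_zpow, len_δ, len_τ]
    omega
  have h : w * δ ^ (2 * m) * τ⁻¹ * θ = w * δ ^ (2 * m + 1) := by rw [θ]; group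
  exact link_reachable_of_mem_face hlozenge (Or.inl rfl) (Or.inr (Or.inl (congrArg edge h.symm)))

theorem link_reachable_outEdge_zero {g w : B4} (hw : Even (len w - len g)) (n : ℤ) :
    (link (paritySurface g) (vtx w)).Reachable (outEdge w n) (outEdge w 0) := by
  have even_reachable (m : ℤ) :
      (link (paritySurface g) (vtx w)).Reachable (outEdge w (2 * m)) (outEdge w 0) := by
    induction m using Int.induction_on with
    | zero => rfl
    | succ m ih => exact (link_reachable_outEdge_add_two hw m).symm.trans ih
    | pred m ih =>
      have h := link_reachable_outEdge_add_two hw (-m - 1)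
      rw [sub_add_cancel] at h
      exact h.trans ih
  obtain ⟨m, rfl | rfl⟩ := n.even_or_odd'
  · exact even_reachable m
  · exact (link_reachable_inEdge_outEdge_add_one hw m).symm.trans
      ((link_reachable_inEdge_outEdge g w (2 * m)).trans (even_reachable m))

theorem exists_vtx_eq_and_even (g : B4) (v : Vertex) :
    ∃ w, vtx w = v ∧ Even (len w - len g) := by
  obtain ⟨w, rfl⟩ := QuotientGroup.mk_surjective v
  rcases Int.even_or_odd (len w - len g) with hw | hw
  · exact ⟨w, rfl, hw⟩
  · refine ⟨w * δ, vtx_mul_δ w, ?_⟩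
    rw [len_mul, len_δ, Int.even_iff]
    rw [Int.odd_iff] at hw
    omega

theorem paritySurface_link_connected (g : B4) (v : Vertex) :
    (link (paritySurface g) v).Connected := by
  obtain ⟨w, rfl, hw⟩ := exists_vtx_eq_and_even g v
  have reachable (x : {e : Sym2 Vertex // e ∈ edges ∧ vtx w ∈ e}) :
      (link (paritySurface g) (vtx w)).Reachable x (outEdge w 0) := by
    obtain ⟨e, he, hwe⟩ := x
    obtain ⟨k, rfl⟩ := mem_edges_iff.1 he
    rcases vtx_mem_edge_iff.1 hwe with ⟨n, rfl⟩ | ⟨n, rfl⟩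
    · exact link_reachable_outEdge_zero hw n
    · exact (link_reachable_inEdge_outEdge g w n).trans (link_reachable_outEdge_zero hw n)
  have : Nonempty {e : Sym2 Vertex // e ∈ edges ∧ vtx w ∈ e} := ⟨outEdge w 0⟩
  exact ⟨fun x y => (reachable x).trans (reachable y).symm⟩

theorem faces_connected_of_link_connected (hS : S ⊆ faces) (hlink : ∀ v, (link S v).Connected)
    {f f' : Set (Sym2 Vertex)} (hf : f ∈ S) (hf' : f' ∈ S) :
    Relation.ReflTransGen (fun a b => a ∈ S ∧ b ∈ S ∧ (a ∩ b).Nonempty) f f' := by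
  let P : B4 → Prop := fun k => ∀ f₁ ∈ S, edge k ∈ f₁ →
    Relation.ReflTransGen (fun a b => a ∈ S ∧ b ∈ S ∧ (a ∩ b).Nonempty) f f₁
  have imp_of_vtx_mem {v : Vertex} {k h : B4} (hk : v ∈ edge k) (hh : v ∈ edge h) : P k → P h := by
    refine link_induction (P := P) (hlink v) ?_ ?_ hk hh
    · exact fun k h hkh hP f₁ hf₁ hhf₁ => hP f₁ hf₁ (hkh ▸ hhf₁)
    · exact fun f₁ hf₁ k h hk hh _ _ hP f₂ hf₂ hhf₂ =>
        (hP f₁ hf₁ hk).tail ⟨hf₁, hf₂, edge h, hh, hhf₂⟩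
  have iff_of_vtx_mem {v : Vertex} {k h : B4} (hk : v ∈ edge k) (hh : v ∈ edge h) : P k ↔ P h :=
    ⟨imp_of_vtx_mem hk hh, imp_of_vtx_mem hh hk⟩
  have invariant := iff_of_mul_right_invariant (P := P)
    (fun k => iff_of_vtx_mem (v := vtx (k * τ)) (by simp [edge]) (by simp [edge]))
    (fun k => iff_of_vtx_mem (v := vtx k) (by simp [edge, vtx_mul_δ]) (by simp [edge]))
  have exists_edge_mem {f} (hf : f ∈ S) : ∃ k, edge k ∈ f := by
    rcases mem_faces_iff.1 (hS hf) with ⟨k, rfl⟩ | ⟨k, rfl⟩ <;> exact ⟨k, Or.inl rfl⟩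
  obtain ⟨k, hk⟩ := exists_edge_mem hf
  obtain ⟨h, hh⟩ := exists_edge_mem hf'
  exact (invariant k h).1 (fun f₁ hf₁ hk₁ => .single ⟨hf, hf₁, edge k, hk, hk₁⟩) f' hf' hh

theorem paritySurface_isHamiltonian (g : B4) : IsHamiltonianSurface (paritySurface g) where
  subset_faces := paritySurface_subset_faces g
  nonempty := ⟨_, triangle_mem_paritySurface g g⟩
  two_faces _ he := encard_paritySurface_faces_eq_two g he
  connected _ hf _ hf' := faces_connected_of_link_connected (paritySurface_subset_faces g)
    (paritySurface_link_connected g) hf hf'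
  link_connected := paritySurface_link_connected g

end Brady

theorem theorem4p1 (f : Set (Sym2 Brady.Vertex)) (hf : Brady.IsLozenge f) :
    ∃! S : Set (Set (Sym2 Brady.Vertex)), Brady.IsHamiltonianSurface S ∧ f ∈ S := by
  obtain ⟨g, rfl⟩ := Brady.isLozenge_iff.1 hf
  exact ⟨Brady.paritySurface g, ⟨Brady.paritySurface_isHamiltonian g,
    Brady.lozenge_mem_paritySurface.2 (by simp)⟩, fun S hS => Brady.eq_paritySurface hS.1 hS.2⟩
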